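/- Let $\operatorname{Aut}(\mathbb{Q},\leq)$ be the group of order-automorphisms of the rationals, i.e. of the bijections $f:\mathbb{Q}\to\mathbb{Q}$ such that $x\leq y$ if and only if $f(x)\leq f(y)$, under composition. For a group $G$: - the cofinality $\operatorname{cf}(G)$ is the least cardinal $\lambda$ such that $G$ is the union of a chain (under inclusion) of $\lambda$ proper subgroups; - the strong cofinality $\operatorname{scf}(G)$ is the least cardinal $\lambda$ such that $G$ is the union of a chain (under inclusion) of $\lambda$ proper subsets, where every member $H$ of the chain satisfies $H=H^{-1}$ and $HH\subseteq K$ for some member $K\supseteq H$ of the chain; - $G$ has Bergman's property if for every generating set $X$ of $G$ with $X=X^{-1}$ and $1\in X$ there is $N\in\mathbb{N}$ such that $G=X^N$. Then $\operatorname{scf}(\operatorname{Aut}(\mathbb{Q},\leq))>\aleph_0$, $\operatorname{cf}(\operatorname{Aut}(\mathbb{Q},\leq))>\aleph_0$, and $\operatorname{Aut}(\mathbb{Q},\leq)$ has Bergman's property. (In particular, chains as in the definitions of $\operatorname{cf}$ and $\operatorname{scf}$ exist for this group.) -/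

import Mathlib

open scoped Pointwise

universe u

/-- The cofinality `cf(G)`: the least cardinal `c` such that `G` is the union of a chain
(with respect to inclusion) of `c` proper subgroups. If there is no such chain the value is `0`,
so a positive lower bound on `groupCofinality G` includes the existence of such a chain. -/
noncomputable def groupCofinality (G : Type u) [Group G] : Cardinal.{u} :=
  sInf {c : Cardinal.{u} | ∃ C : Set (Subgroup G),
    IsChain (· ≤ ·) C ∧ Cardinal.mk C = c ∧ (∀ H ∈ C, H ≠ ⊤) ∧
    (⋃ H ∈ C, (H : Set G)) = Set.univ}

/-- The strong cofinality `scf(G)`: the least cardinal `c` such that `G` is the union of a chain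
(with respect to inclusion) of `c` proper subsets, each of them closed under inverses, and such
that for every member `H` of the chain there is a member `K ⊇ H` with `H * H ⊆ K`.
If there is no such chain the value is `0`, so a positive lower bound on
`groupStrongCofinality G` includes the existence of such a chain. -/
noncomputable def groupStrongCofinality (G : Type u) [Group G] : Cardinal.{u} :=
  sInf {c : Cardinal.{u} | ∃ C : Set (Set G),
    IsChain (· ⊆ ·) C ∧ Cardinal.mk C = c ∧ (∀ H ∈ C, H ≠ Set.univ) ∧
    (∀ H ∈ C, H = H⁻¹) ∧ (∀ H ∈ C, ∃ K ∈ C, H ⊆ K ∧ H * H ⊆ K) ∧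
    ⋃₀ C = Set.univ}

/-- Bergman's property: for every generating set `X` of `G` with `X = X⁻¹` and `1 ∈ X` there is
`N` such that every element of `G` is a product of `N` elements of `X`
(`X ^ N` is the pointwise power of the set `X`). -/
def HasBergmanProperty (G : Type u) [Group G] : Prop :=
  ∀ X : Set G, Subgroup.closure X = ⊤ → X = X⁻¹ → (1 : G) ∈ X →
    ∃ N : ℕ, X ^ N = Set.univ

/-! All three claims follow from `IsExhaustion.exists_eq_univ`: an increasing sequence `U` of
symmetric sets covering the group, with `U n * U n ⊆ U (n + 1)`, reaches the whole group at a finite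
stage. The powers `X ^ (2 ^ n)` of a symmetric generating set containing `1` form such a sequence,
and so does a suitable sequence of members of a countable chain.

The engine is diagonalisation. The unit cells of `ℚ` carry labels, each occurring arbitrarily far
out in both directions. If every `U n` missed some prescribed behaviour on the intervals with label
`n`, one automorphism glued from all these behaviours would lie in no `U n`. This gives an `n` such
that `U n` induces every automorphism of block `n`, up to uncontrolled action on the other blocks
(`IsExhaustion.exists_blockSet_extension`). Every automorphism of a block is a commutator `[h, l]`;
extending `h` and `l` so that their unwanted parts have disjoint supports makes those parts cancel,
so a fixed `U m` contains all automorphisms supported on block `n`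
(`IsExhaustion.exists_supported_mem`).

A second diagonalisation (`IsExhaustion.exists_map_into_fixedPoints`) conjugates any automorphism
with fixed intervals arbitrarily far out on both sides into that block, by elements of bounded
level. Since every automorphism is a product of two of these, some `U n` is everything.

The cofinalities are infima, equal to `0` over an empty set, so chains must also be exhibited.
Bergman's property makes this infinite group not finitely generated, and initial segments of a
well-ordered generating set of least cardinality then generate a chain of proper subgroups. -/

/-! ### Gluing order automorphisms of `ℚ` -/

/-- Two automorphisms agreeing at `c` can be glued at `c`. -/
theorem exists_orderIso_glue_at (φ ψ : ℚ ≃o ℚ) (c : ℚ) (h : φ c = ψ c) :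
    ∃ f : ℚ ≃o ℚ, (∀ x ≤ c, f x = φ x) ∧ ∀ x, c ≤ x → f x = ψ x := by
  have hmono : StrictMono (fun x => if x ≤ c then φ x else ψ x) := by
    intro x y hxy
    dsimp only
    split_ifs with h1 h2 h2
    · exact φ.strictMono hxy
    · exact (φ.monotone h1).trans_lt (h ▸ ψ.strictMono (not_le.1 h2))
    · exact absurd (hxy.le.trans h2) h1
    · exact ψ.strictMono hxy
  have hsurj : Function.Surjective (fun x => if x ≤ c then φ x else ψ x) := by
    intro y
    by_cases hy : y ≤ φ c
    · refine ⟨φ.symm y, ?_⟩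
      have : φ.symm y ≤ c := by rwa [φ.symm_apply_le]
      simp [this]
    · refine ⟨ψ.symm y, ?_⟩
      have : ¬ ψ.symm y ≤ c := by rwa [ψ.symm_apply_le, ← h]
      simp [this]
  refine ⟨hmono.orderIsoOfSurjective _ hsurj, fun x hx => ?_, fun x hx => ?_⟩
  · simp [hx]
  · rcases hx.eq_or_lt with rfl | hx
    · simp [h]
    · simp [not_le.2 hx]

/-- A sequence `ℤ → ℚ` that is unbounded in both directions. -/
def UnboundedBothWays (a : ℤ → ℚ) : Prop :=
  (∀ x, ∃ k, a k ≤ x) ∧ ∀ x, ∃ k, x < a k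

theorem UnboundedBothWays.exists_mem_Ico {a : ℤ → ℚ} (ha : StrictMono a)
    (hu : UnboundedBothWays a) (x : ℚ) : ∃ k, a k ≤ x ∧ x < a (k + 1) := by
  obtain ⟨i, hi⟩ := hu.1 x
  obtain ⟨j, hj⟩ := hu.2 x
  obtain ⟨k, hk, hmax⟩ := Int.exists_greatest_of_bdd (P := fun k => a k ≤ x)
    ⟨j, fun z hz => (ha.lt_iff_lt.1 (hz.trans_lt hj)).le⟩ ⟨i, hi⟩
  refine ⟨k, hk, not_le.1 fun h => ?_⟩
  have := hmax _ h
  lia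

theorem unboundedBothWays_intCast : UnboundedBothWays (fun k : ℤ => (k : ℚ)) :=
  ⟨fun x => ⟨⌊x⌋, Int.floor_le x⟩, fun x => ⟨⌊x⌋ + 1, by simp⟩⟩

/-- Automorphisms can be glued along a sequence of points indexed by `ℤ`. -/
theorem exists_orderIso_glue {a b : ℤ → ℚ} (ha : StrictMono a) (hb : StrictMono b)
    (hau : UnboundedBothWays a) (hbu : UnboundedBothWays b) (φ : ℤ → ℚ ≃o ℚ)
    (h₀ : ∀ k, φ k (a k) = b k) (h₁ : ∀ k, φ k (a (k + 1)) = b (k + 1)) :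
    ∃ f : ℚ ≃o ℚ, ∀ k x, a k ≤ x → x ≤ a (k + 1) → f x = φ k x := by
  choose i hi hi' using hau.exists_mem_Ico ha
  have huniq : ∀ k x, a k ≤ x → x < a (k + 1) → i x = k := by
    intro k x h1 h2
    have h3 := ha.lt_iff_lt.1 ((hi x).trans_lt h2)
    have h4 := ha.lt_iff_lt.1 (h1.trans_lt (hi' x))
    lia
  have hmono : StrictMono (fun x => φ (i x) x) := by
    intro x y hxy
    dsimp only
    have hle : i x ≤ i y := by
      have := ha.lt_iff_lt.1 ((hi x).trans_lt (hxy.trans (hi' y)))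
      lia
    rcases hle.eq_or_lt with he | hlt
    · rw [he]; exact (φ _).strictMono hxy
    · calc φ (i x) x < φ (i x) (a (i x + 1)) := (φ _).strictMono (hi' x)
        _ = b (i x + 1) := h₁ _
        _ ≤ b (i y) := hb.monotone (by lia)
        _ = φ (i y) (a (i y)) := (h₀ _).symm
        _ ≤ φ (i y) y := (φ _).monotone (hi y)
  have hsurj : Function.Surjective (fun x => φ (i x) x) := by
    intro y
    obtain ⟨k, hk, hk'⟩ := hbu.exists_mem_Ico hb y
    refine ⟨(φ k).symm y, ?_⟩
    have : i ((φ k).symm y) = k := by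
      apply huniq
      · rwa [(φ k).le_symm_apply, h₀]
      · rwa [(φ k).symm_apply_lt, h₁]
    simp [this]
  refine ⟨hmono.orderIsoOfSurjective _ hsurj, fun k x h1 h2 => ?_⟩
  rcases h2.eq_or_lt with rfl | h2
  · have : i (a (k + 1)) = k + 1 := huniq _ _ le_rfl (ha (by lia))
    simp [this, h₀, h₁]
  · simp [huniq k x h1 h2]

/-- The affine automorphism of `ℚ` mapping `a` to `c` and `b` to `d`. -/
theorem exists_orderIso_map_pair {a b c d : ℚ} (hab : a < b) (hcd : c < d) :
    ∃ f : ℚ ≃o ℚ, f a = c ∧ f b = d := by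
  have h : 0 < (d - c) / (b - a) := div_pos (sub_pos.2 hcd) (sub_pos.2 hab)
  refine ⟨((OrderIso.addRight (-a)).trans (OrderIso.mulLeft₀ _ h)).trans (OrderIso.addRight c),
    ?_, ?_⟩
  · simp
  · have : b - a ≠ 0 := (sub_pos.2 hab).ne'
    simp only [OrderIso.trans_apply, OrderIso.addRight_apply, OrderIso.mulLeft₀_apply]
    field_simp
    ring

/-- An automorphism mapping a two-sided sequence of intervals onto another one. -/
theorem exists_orderIso_map_intervals {p q p' q' : ℤ → ℚ} (hpq : ∀ k, p k < q k)
    (hqp : ∀ k, q k < p (k + 1)) (hpq' : ∀ k, p' k < q' k) (hqp' : ∀ k, q' k < p' (k + 1))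
    (hu : UnboundedBothWays p) (hu' : UnboundedBothWays p') :
    ∃ w : ℚ ≃o ℚ, ∀ k, w (p k) = p' k ∧ w (q k) = q' k := by
  have hloc : ∀ k, ∃ φ : ℚ ≃o ℚ, φ (p k) = p' k ∧ φ (q k) = q' k ∧
      φ (p (k + 1)) = p' (k + 1) := by
    intro k
    obtain ⟨f, hf, hf'⟩ := exists_orderIso_map_pair (hpq k) (hpq' k)
    obtain ⟨g, hg, hg'⟩ := exists_orderIso_map_pair (hqp k) (hqp' k)
    obtain ⟨φ, h1, h2⟩ := exists_orderIso_glue_at f g (q k) (hf'.trans hg.symm)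
    exact ⟨φ, by rw [h1 _ (hpq k).le, hf], by rw [h1 _ le_rfl, hf'], by rw [h2 _ (hqp k).le, hg']⟩
  choose φ h0 h1 h2 using hloc
  obtain ⟨w, hw⟩ := exists_orderIso_glue
    (strictMono_int_of_lt_succ fun k => (hpq k).trans (hqp k))
    (strictMono_int_of_lt_succ fun k => (hpq' k).trans (hqp' k)) hu hu' φ h0 h2
  refine ⟨w, fun k => ⟨?_, ?_⟩⟩
  · rw [hw k _ le_rfl ((hpq k).trans (hqp k)).le, h0]
  · rw [hw k _ (hpq k).le (hqp k).le, h1]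

/-- Choosing a two-sided unbounded sequence of disjoint intervals, the `k`-th one from a family
`T k` with members arbitrarily far to the left and to the right. -/
theorem exists_intervals (T : ℤ → ℚ → ℚ → Prop)
    (hup : ∀ k x, ∃ p q, x < p ∧ p < q ∧ T k p q) (hdown : ∀ k x, ∃ p q, p < q ∧ q < x ∧ T k p q) :
    ∃ p q : ℤ → ℚ, (∀ k, p k < q k) ∧ (∀ k, q k < p (k + 1)) ∧ (∀ k, T k (p k) (q k)) ∧
      UnboundedBothWays p := by
  choose P Q hP hPQ hT using hup
  choose P' Q' hPQ' hQ' hT' using hdown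
  -- `r n` is the right endpoint of interval `n` and `up n` the point it must lie beyond; taking the
  -- maximum with `n` forces unboundedness. The left half mirrors this, starting from `P 0 0`, the
  -- left endpoint of interval `0`.
  let r : ℕ → ℚ := fun n => Nat.rec (Q 0 0) (fun n y => Q (n + 1) (max y n)) n
  let up : ℕ → ℚ := fun n => Nat.casesOn n 0 (fun n => max (r n) n)
  have hr : ∀ n : ℕ, r n = Q n (up n) := by
    intro n; cases n <;> simp [r, up]
  let l : ℕ → ℚ := fun n => Nat.rec (P' (-1) (P 0 0))
    (fun n y => P' (Int.negSucc (n + 1)) (min y (-n))) n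
  let dn : ℕ → ℚ := fun n => Nat.casesOn n (P 0 0) (fun n => min (l n) (-n))
  have hl : ∀ n : ℕ, l n = P' (Int.negSucc n) (dn n) := by
    intro n; cases n <;> simp [l, dn]
  let p : ℤ → ℚ := fun k => Int.casesOn k (fun n => P n (up n)) (fun n => l n)
  let q : ℤ → ℚ := fun k => Int.casesOn k (fun n => r n) (fun n => Q' (Int.negSucc n) (dn n))
  refine ⟨p, q, ?_, ?_, ?_, ?_, ?_⟩
  · rintro (n | n)
    · change P n (up n) < r n
      rw [hr]; exact hPQ _ _
    · change l n < _
      rw [hl]; exact hPQ' _ _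
  · rintro (n | _ | n)
    · exact (le_max_left _ _).trans_lt (hP (n + 1) (up (n + 1)))
    · exact hQ' _ _
    · have : Int.negSucc (n + 1) + 1 = Int.negSucc n := by lia
      rw [this]
      exact (hQ' (Int.negSucc (n + 1)) (dn (n + 1))).trans_le (min_le_left _ _)
  · rintro (n | n)
    · change T n (P n (up n)) (r n)
      rw [hr]; exact hT _ _
    · change T _ (l n) _
      rw [hl]; exact hT' _ _
  · intro x
    obtain ⟨n, hn⟩ := exists_nat_gt (-x)
    refine ⟨Int.negSucc (n + 1), ?_⟩
    change l (n + 1) ≤ x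
    have h1 := (hPQ' (Int.negSucc (n + 1)) (dn (n + 1))).trans (hQ' _ _)
    have h2 : dn (n + 1) ≤ -n := min_le_right _ _
    exact (hl (n + 1)).le.trans (by linarith)
  · intro x
    obtain ⟨n, hn⟩ := exists_nat_gt x
    refine ⟨(n + 1 : ℕ), ?_⟩
    change x < P (n + 1 : ℕ) (up (n + 1))
    have h1 := hP (n + 1 : ℕ) (up (n + 1))
    have h2 : (n : ℚ) ≤ up (n + 1) := le_max_right _ _
    linarith

/-! ### Every order automorphism of `ℚ` is a commutator -/

theorem exists_orderIso_sup (f g : ℚ ≃o ℚ) : ∃ h : ℚ ≃o ℚ, ∀ x, h x = max (f x) (g x) := by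
  have hmono : StrictMono (fun x => max (f x) (g x)) := fun x y hxy =>
    max_lt_max (f.strictMono hxy) (g.strictMono hxy)
  have hsurj : Function.Surjective (fun x => max (f x) (g x)) := by
    intro y
    rcases le_total (f.symm y) (g.symm y) with h | h
    · exact ⟨f.symm y, by simpa using g.le_symm_apply.1 h⟩
    · exact ⟨g.symm y, by simpa using f.le_symm_apply.1 h⟩
  exact ⟨hmono.orderIsoOfSurjective _ hsurj, fun x => by simp⟩

/-- An automorphism moving every point by at least `1` to the right is conjugate to the
translation by `1`. -/
theorem exists_conj_translation (t : ℚ ≃o ℚ) (ht : ∀ x, x + 1 ≤ t x) :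
    ∃ p : ℚ ≃o ℚ, t = p * OrderIso.addRight (1 : ℚ) * p⁻¹ := by
  have hsucc : ∀ k : ℤ, (t ^ (k + 1)) 0 = t ((t ^ k) 0) := fun k => by
    rw [add_comm, zpow_add, zpow_one, RelIso.mul_apply]
  -- The orbit of `0` gains at least `1` per step, hence is unbounded in both directions; its points
  -- cut `ℚ` into fundamental domains for `t`.
  have hmono : Monotone (fun k : ℤ => (t ^ k) 0 - k) := by
    refine monotone_int_of_le_succ fun k => ?_
    have := ht ((t ^ k) 0)
    simp only [hsucc]
    push_cast
    linarith
  have hs : StrictMono (fun k : ℤ => (t ^ k) 0) := by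
    refine strictMono_int_of_lt_succ fun k => ?_
    have := ht ((t ^ k) 0)
    simp only [hsucc]
    linarith
  have hu : UnboundedBothWays (fun k : ℤ => (t ^ k) 0) := by
    constructor
    · intro x
      refine ⟨min ⌊x⌋ 0, ?_⟩
      have h1 := hmono (min_le_right ⌊x⌋ 0)
      have h2 : ((min ⌊x⌋ 0 : ℤ) : ℚ) ≤ ⌊x⌋ := by exact_mod_cast min_le_left _ _
      have h3 := Int.floor_le x
      simp only [zpow_zero, RelIso.one_apply, Int.cast_zero, sub_zero] at h1
      linarith
    · intro x
      refine ⟨max (⌊x⌋ + 1) 0, ?_⟩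
      have h1 := hmono (le_max_right (⌊x⌋ + 1) 0)
      have h2 : ((⌊x⌋ + 1 : ℤ) : ℚ) ≤ (max (⌊x⌋ + 1) 0 : ℤ) := by exact_mod_cast le_max_left _ _
      have h3 := Int.lt_floor_add_one x
      simp only [zpow_zero, RelIso.one_apply, Int.cast_zero, sub_zero] at h1
      push_cast at h1 h2
      linarith
  obtain ⟨φ, h0, h1⟩ := exists_orderIso_map_pair (zero_lt_one (α := ℚ))
    (show (0 : ℚ) < t 0 by have := ht 0; linarith)
  -- On `[k, k + 1]` the conjugator is `x ↦ t ^ k (φ (x - k))`, so that `p (x + 1) = t (p x)`.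
  obtain ⟨p, hp⟩ := exists_orderIso_glue (a := fun k : ℤ => (k : ℚ)) (b := fun k : ℤ => (t ^ k) 0)
    (Int.cast_strictMono) hs unboundedBothWays_intCast hu
    (fun k => t ^ k * φ * OrderIso.addRight (-k : ℚ))
    (fun k => by simp [RelIso.mul_apply, h0])
    (fun k => by
      rw [hsucc, ← RelIso.mul_apply t, mul_self_zpow, zpow_add_one]
      simp [RelIso.mul_apply, h1])
  refine ⟨p, ?_⟩
  rw [eq_mul_inv_iff_mul_eq]
  ext x
  have h3 := Int.floor_le x
  have h4 := (Int.lt_floor_add_one x).le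
  have hx := hp ⌊x⌋ x h3 (by push_cast; exact h4)
  have hx' := hp (⌊x⌋ + 1) (x + 1) (by push_cast; linarith) (by push_cast; linarith)
  simp only [RelIso.mul_apply, OrderIso.addRight_apply] at hx hx' ⊢
  rw [hx, hx', ← RelIso.mul_apply t, mul_self_zpow]
  congr 2
  push_cast
  ring

/-- With `t x = max (x + 1) (f⁻¹ (x + 1))`, both `t` and `f * t` move every point right by at least
`1`. Both are thus conjugate to the translation by `1`, hence to each other: `f * t = h * t * h⁻¹`.
-/
theorem exists_eq_commutator (f : ℚ ≃o ℚ) : ∃ h l : ℚ ≃o ℚ, f = h * l * h⁻¹ * l⁻¹ := by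
  obtain ⟨t, ht⟩ := exists_orderIso_sup (OrderIso.addRight (1 : ℚ))
    (f⁻¹ * OrderIso.addRight (1 : ℚ))
  obtain ⟨q, hq⟩ := exists_conj_translation t fun x => by rw [ht]; exact le_max_left _ _
  obtain ⟨p, hp⟩ := exists_conj_translation (f * t) fun x => by
    rw [RelIso.mul_apply, ht]
    calc x + 1 = f ((f⁻¹ * OrderIso.addRight (1 : ℚ)) x) := by simp [RelIso.mul_apply]
      _ ≤ _ := f.monotone (le_max_right _ _)
  refine ⟨p * q⁻¹, t, ?_⟩
  have : f = f * t * t⁻¹ := by group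
  rw [this, hp]
  conv_rhs => rw [hq]
  conv_lhs => rw [hq]
  group

/-- Transport of an automorphism of `ℚ` to an open interval, extended by the identity. -/
theorem exists_extend_Ioo {a b : ℚ} (e : ℚ ≃o Set.Ioo a b) (r : ℚ ≃o ℚ) :
    ∃ h : ℚ ≃o ℚ, (∀ y, h (e y) = e (r y)) ∧ ∀ x ∉ Set.Ioo a b, h x = x := by
  classical
  let F : ℚ → ℚ := fun x => if hx : x ∈ Set.Ioo a b then e (r (e.symm ⟨x, hx⟩)) else x
  have hin : ∀ y, F (e y) = e (r y) := fun y => by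
    simp only [F, dif_pos (e y).2, Subtype.coe_eta, e.symm_apply_apply]
  have hout : ∀ x ∉ Set.Ioo a b, F x = x := fun x hx => by simp only [F, dif_neg hx]
  have hcase : ∀ x, x ∈ Set.Ioo a b → ∃ y, (e y : ℚ) = x := fun x hx =>
    ⟨e.symm ⟨x, hx⟩, by simp⟩
  have hmono : StrictMono F := by
    intro x y hxy
    by_cases hx : x ∈ Set.Ioo a b <;> by_cases hy : y ∈ Set.Ioo a b
    · obtain ⟨x, rfl⟩ := hcase x hx
      obtain ⟨y, rfl⟩ := hcase y hy
      rw [hin, hin]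
      have : x < y := e.lt_iff_lt.1 hxy
      exact e.strictMono (r.strictMono this)
    · obtain ⟨x, rfl⟩ := hcase x hx
      rw [hin, hout y hy]
      have h1 : b ≤ y := not_lt.1 fun h => hy ⟨hx.1.trans hxy, h⟩
      exact (e (r x)).2.2.trans_le h1
    · obtain ⟨y, rfl⟩ := hcase y hy
      rw [hin, hout x hx]
      have h1 : x ≤ a := not_lt.1 fun h => hx ⟨h, hxy.trans hy.2⟩
      exact h1.trans_lt (e (r y)).2.1
    · rwa [hout x hx, hout y hy]
  have hsurj : Function.Surjective F := by
    intro y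
    by_cases hy : y ∈ Set.Ioo a b
    · obtain ⟨y, rfl⟩ := hcase y hy
      exact ⟨e (r.symm y), by rw [hin, r.apply_symm_apply]⟩
    · exact ⟨y, hout y hy⟩
  exact ⟨hmono.orderIsoOfSurjective _ hsurj, fun y => by simpa using hin y,
    fun x hx => by simpa using hout x hx⟩

/-- On an interval whose endpoints it fixes, an automorphism is a commutator of automorphisms
supported on that interval. -/
theorem exists_commutator_on_Ioo {a b : ℚ} (hab : a < b) (g : ℚ ≃o ℚ) (ha : g a = a)
    (hb : g b = b) : ∃ h l : ℚ ≃o ℚ, (∀ x ∉ Set.Ioo a b, h x = x) ∧ (∀ x ∉ Set.Ioo a b, l x = x) ∧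
      ∀ x ∈ Set.Ioo a b, (h * l * h⁻¹ * l⁻¹) x = g x := by
  have : Nonempty (Set.Ioo a b) := (exists_between hab).elim fun x hx => ⟨⟨x, hx⟩⟩
  -- By Cantor's theorem the open interval is a copy of `ℚ`, so the restriction of `g` is a
  -- commutator there.
  obtain ⟨e⟩ := Order.iso_of_countable_dense ℚ (Set.Ioo a b)
  have hg : ∀ x, x ∈ Set.Ioo a b ↔ g x ∈ Set.Ioo a b := fun x => by
    rw [Set.mem_Ioo, Set.mem_Ioo, ← g.lt_iff_lt (x := a), ← g.lt_iff_lt (y := b), ha, hb]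
  let f : ℚ ≃o ℚ := (e.trans ⟨g.toEquiv.subtypeEquiv hg, g.map_rel_iff⟩).trans e.symm
  have hf : ∀ y, (e (f y) : ℚ) = g (e y) := fun y => by
    simp [f, -Set.mem_Ioo]
    rfl
  obtain ⟨r, s, hrs⟩ := exists_eq_commutator f
  obtain ⟨h, h1, h2⟩ := exists_extend_Ioo e r
  obtain ⟨l, l1, l2⟩ := exists_extend_Ioo e s
  refine ⟨h, l, h2, l2, fun x hx => ?_⟩
  obtain ⟨y, rfl⟩ : ∃ y, (e y : ℚ) = x := ⟨e.symm ⟨x, hx⟩, by simp⟩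
  have h3 : ∀ y, h⁻¹ (e y) = e (r⁻¹ y) := fun y => by
    apply h.injective; rw [h1]; simp
  have l3 : ∀ y, l⁻¹ (e y) = e (s⁻¹ y) := fun y => by
    apply l.injective; rw [l1]; simp
  rw [← hf, hrs]
  simp only [RelIso.mul_apply, h1, l1, h3, l3]

/-! ### Exhaustions by symmetric sets and the automorphisms supported on a block -/

/-- An increasing sequence of symmetric sets exhausting a group, such that a product of two
elements of one set lies in the next. -/
structure IsExhaustion {G : Type u} [Group G] (U : ℕ → Set G) : Prop where
  mono : Monotone U
  inv_mem : ∀ n x, x ∈ U n → x⁻¹ ∈ U n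
  mul_mem : ∀ n x y, x ∈ U n → y ∈ U n → x * y ∈ U (n + 1)
  exists_mem : ∀ x, ∃ n, x ∈ U n

theorem IsExhaustion.mul_mem_of_le {G : Type u} [Group G] {U : ℕ → Set G} (hU : IsExhaustion U)
    {m n : ℕ} (hnm : n ≤ m) {x y : G} (hx : x ∈ U m) (hy : y ∈ U n) : x * y ∈ U (m + 1) :=
  hU.mul_mem m x y hx (hU.mono hnm hy)

/-- A labelling of the integers by natural numbers taking each value arbitrarily far to the left
and to the right. -/
def blockIndex (k : ℤ) : ℕ := (Nat.unpair k.natAbs).1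

theorem exists_gt_blockIndex_eq (n : ℕ) (x : ℚ) : ∃ k : ℤ, x < k ∧ blockIndex k = n := by
  obtain ⟨j, hj⟩ := exists_nat_gt x
  refine ⟨Nat.pair n j, hj.trans_le ?_, by simp [blockIndex]⟩
  exact_mod_cast Nat.right_le_pair n j

theorem exists_lt_blockIndex_eq (n : ℕ) (x : ℚ) : ∃ k : ℤ, k < x ∧ blockIndex k = n := by
  obtain ⟨j, hj⟩ := exists_nat_gt (-x)
  refine ⟨-Nat.pair n j, ?_, by simp [blockIndex]⟩
  have : (j : ℚ) ≤ Nat.pair n j := by exact_mod_cast Nat.right_le_pair n j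
  push_cast
  linarith

/-- The union of the intervals `(k, k + 1/2)` with `k` of label `n`. -/
def blockSet (n : ℕ) : Set ℚ := {x | ∃ k : ℤ, blockIndex k = n ∧ k < x ∧ x < k + 1 / 2}

theorem blockIndex_eq_of_mem {n : ℕ} {x : ℚ} {k : ℤ} (hx : x ∈ blockSet n) (h₀ : k ≤ x)
    (h₁ : x ≤ k + 1) : blockIndex k = n ∧ k < x ∧ x < k + 1 / 2 := by
  obtain ⟨j, hj, h2, h3⟩ := hx
  have h4 : (j : ℚ) < (k + 1 : ℤ) := by push_cast; linarith
  have h5 : (k : ℚ) < (j + 1 : ℤ) := by push_cast; linarith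
  have : j = k := by
    have := Int.cast_lt.1 h4
    have := Int.cast_lt.1 h5
    lia
  subst this
  exact ⟨hj, h2, h3⟩

theorem intCast_notMem_blockSet (n : ℕ) (k : ℤ) : (k : ℚ) ∉ blockSet n := fun h =>
  lt_irrefl _ (blockIndex_eq_of_mem h le_rfl (by linarith)).2.1

theorem commute_of_disjoint {f g : ℚ ≃o ℚ} (h : ∀ x, f x = x ∨ g x = x) : Commute f g := by
  have := Equiv.Perm.Disjoint.commute (f := f.toEquiv) (g := g.toEquiv) h
  ext x
  exact congrArg (fun e : Equiv.Perm ℚ => e x) this.eq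

theorem inv_apply_eq_self {f : ℚ ≃o ℚ} {x : ℚ} (h : f x = x) : f⁻¹ x = x := by
  conv_lhs => rw [← h]
  simp

theorem apply_mem_of_supported {A : Set ℚ} {f : ℚ ≃o ℚ} (hf : ∀ x ∉ A, f x = x) {x : ℚ}
    (hx : x ∈ A) : f x ∈ A := by
  by_contra h
  have := f.injective (hf _ h)
  exact h (this.symm ▸ hx)

/-- If `h'` agrees with `h` on the set `A` supporting `h`, then `h⁻¹ * h'` fixes `A` and agrees
with `h'` off `A`. -/
theorem inv_mul_apply_of_agree {A : Set ℚ} {h h' : ℚ ≃o ℚ} (hh : ∀ x ∉ A, h x = x)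
    (ha : ∀ x ∈ A, h' x = h x) :
    (∀ x ∈ A, (h⁻¹ * h') x = x) ∧ ∀ x ∉ A, (h⁻¹ * h') x = h' x := by
  refine ⟨fun x hx => by simp [RelIso.mul_apply, ha x hx], fun x hx => ?_⟩
  have hx' : h' x ∉ A := by
    intro hmem
    have h1 : h⁻¹ (h' x) ∈ A :=
      apply_mem_of_supported (fun y hy => inv_apply_eq_self (hh y hy)) hmem
    have h2 := ha _ h1
    rw [RelIso.apply_inv_self] at h2
    exact hx (h'.injective h2 ▸ h1)
  exact inv_apply_eq_self (hh _ hx')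

/-- A commutator only depends on the restrictions to the common support. -/
theorem commutator_eq_of_agree {A : Set ℚ} {h l h' l' : ℚ ≃o ℚ} (hh : ∀ x ∉ A, h x = x)
    (hl : ∀ x ∉ A, l x = x) (hh' : ∀ x ∈ A, h' x = h x) (hl' : ∀ x ∈ A, l' x = l x)
    (hd : ∀ x ∉ A, h' x = x ∨ l' x = x) :
    h' * l' * h'⁻¹ * l'⁻¹ = h * l * h⁻¹ * l⁻¹ := by
  obtain ⟨h1, h2⟩ := inv_mul_apply_of_agree hh hh'
  obtain ⟨l1, l2⟩ := inv_mul_apply_of_agree hl hl'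
  -- The corrections `a` and `b` live off `A`. Hence `a` commutes with `l`, `b` with `h`, and by
  -- `hd` also `a` with `b`, so both cancel from the commutator.
  obtain ⟨a, ha⟩ : ∃ a, a = h⁻¹ * h' := ⟨_, rfl⟩
  obtain ⟨b, hb⟩ : ∃ b, b = l⁻¹ * l' := ⟨_, rfl⟩
  rw [← ha] at h1 h2
  rw [← hb] at l1 l2
  obtain rfl : h' = h * a := by rw [ha]; group
  obtain rfl : l' = l * b := by rw [hb]; group
  have c1 : Commute a l := commute_of_disjoint fun x =>
    (em (x ∈ A)).imp (h1 x) (hl x)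
  have c2 : Commute h b := commute_of_disjoint fun x =>
    (em (x ∈ A)).symm.imp (hh x) (l1 x)
  have c3 : Commute a b := commute_of_disjoint fun x => by
    by_cases hx : x ∈ A
    · exact .inl (h1 x hx)
    · rw [h2 x hx, l2 x hx]; exact hd x hx
  have c4 : a * (l * b) * a⁻¹ = l * b := by
    rw [(c1.mul_right c3).eq]; group
  have c5 : b * h⁻¹ * b⁻¹ = h⁻¹ := by
    rw [(c2.inv_left).symm.eq]; group
  calc h * a * (l * b) * (h * a)⁻¹ * (l * b)⁻¹
      = h * (a * (l * b) * a⁻¹) * h⁻¹ * b⁻¹ * l⁻¹ := by group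
    _ = h * l * (b * h⁻¹ * b⁻¹) * l⁻¹ := by rw [c4]; group
    _ = _ := by rw [c5]

/-- The commutator representations on the separate intervals of the block can be chosen
independently and glued at the integers, which all factors fix. -/
theorem exists_commutator_on_blockSet {n : ℕ} {g : ℚ ≃o ℚ} (hg : ∀ x ∉ blockSet n, g x = x) :
    ∃ h l : ℚ ≃o ℚ, (∀ x ∉ blockSet n, h x = x) ∧ (∀ x ∉ blockSet n, l x = x) ∧
      g = h * l * h⁻¹ * l⁻¹ := by
  have hloc : ∀ k : ℤ, ∃ h l : ℚ ≃o ℚ,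
      (∀ x : ℚ, k ≤ x → x ≤ k + 1 → x ∉ blockSet n → h x = x) ∧
      (∀ x : ℚ, k ≤ x → x ≤ k + 1 → x ∉ blockSet n → l x = x) ∧
      ∀ x : ℚ, k ≤ x → x ≤ k + 1 → x ∈ blockSet n → (h * l * h⁻¹ * l⁻¹) x = g x := by
    intro k
    by_cases hk : blockIndex k = n
    · obtain ⟨h, l, h1, h2, h3⟩ := exists_commutator_on_Ioo
        (show (k : ℚ) < k + 1 / 2 by linarith) g (hg _ (intCast_notMem_blockSet _ _))
        (hg _ fun h => (blockIndex_eq_of_mem h (by linarith) (by linarith)).2.2.false)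
      refine ⟨h, l, fun x _ _ hx => h1 x fun h => hx ⟨k, hk, h⟩,
        fun x _ _ hx => h2 x fun h => hx ⟨k, hk, h⟩, fun x hx hx' hm => h3 x ?_⟩
      exact (blockIndex_eq_of_mem hm hx hx').2
    · exact ⟨1, 1, fun _ _ _ _ => rfl, fun _ _ _ _ => rfl,
        fun x hx hx' hm => absurd (blockIndex_eq_of_mem hm hx hx').1 hk⟩
  choose h l hh hl hc using hloc
  have key : ∀ h : ℤ → ℚ ≃o ℚ,
      (∀ (k : ℤ) (x : ℚ), k ≤ x → x ≤ k + 1 → x ∉ blockSet n → h k x = x) →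
      ∃ f : ℚ ≃o ℚ, ∀ (k : ℤ) (x : ℚ), k ≤ x → x ≤ k + 1 → f x = h k x := by
    intro h hh
    obtain ⟨f, hf⟩ := exists_orderIso_glue (a := fun k : ℤ => (k : ℚ)) (b := fun k : ℤ => (k : ℚ))
      Int.cast_strictMono Int.cast_strictMono unboundedBothWays_intCast unboundedBothWays_intCast h
      (fun k => hh k _ le_rfl (by linarith) (intCast_notMem_blockSet _ _))
      (fun k => hh k _ (by push_cast; linarith) (by push_cast; linarith)
        (intCast_notMem_blockSet _ _))
    exact ⟨f, fun k x h1 h2 => hf k x h1 (by push_cast; exact h2)⟩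
  obtain ⟨H, hH⟩ := key h hh
  obtain ⟨K, hK⟩ := key l hl
  have hcell : ∀ x : ℚ, ∃ k : ℤ, k ≤ x ∧ x ≤ k + 1 := fun x =>
    ⟨⌊x⌋, Int.floor_le x, (Int.lt_floor_add_one x).le⟩
  have hH' : ∀ x ∉ blockSet n, H x = x := fun x hx => by
    obtain ⟨k, h1, h2⟩ := hcell x
    rw [hH k x h1 h2, hh k x h1 h2 hx]
  have hK' : ∀ x ∉ blockSet n, K x = x := fun x hx => by
    obtain ⟨k, h1, h2⟩ := hcell x
    rw [hK k x h1 h2, hl k x h1 h2 hx]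
  refine ⟨H, K, hH', hK', ?_⟩
  ext x
  by_cases hx : x ∈ blockSet n
  · obtain ⟨k, h1, h2⟩ := hcell x
    rw [← hc k x h1 h2 hx]
    -- The local factors preserve the cell `[k, k + 1]`, so there the inverses of the glued maps are
    -- the inverses of the local ones.
    have hfix : ∀ f : ℚ ≃o ℚ, (∀ x : ℚ, k ≤ x → x ≤ k + 1 → x ∉ blockSet n → f x = x) →
        ∀ x : ℚ, (k ≤ f x ↔ k ≤ x) ∧ (f x ≤ k + 1 ↔ x ≤ k + 1) := by
      intro f hf x
      have e1 : f k = k := hf k le_rfl (by linarith) (intCast_notMem_blockSet _ _)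
      have e2 : f (k + 1) = k + 1 := hf (k + 1) (by linarith) le_rfl
        (by exact_mod_cast intCast_notMem_blockSet n (k + 1))
      constructor
      · conv_lhs => rw [← e1]
        exact f.le_iff_le
      · conv_lhs => rw [← e2]
        exact f.le_iff_le
    have hinv : ∀ F f : ℚ ≃o ℚ, (∀ x : ℚ, k ≤ x → x ≤ k + 1 → F x = f x) →
        (∀ x : ℚ, k ≤ x → x ≤ k + 1 → x ∉ blockSet n → f x = x) →
        ∀ x : ℚ, k ≤ x → x ≤ k + 1 →
          F⁻¹ x = f⁻¹ x ∧ (k : ℚ) ≤ f⁻¹ x ∧ f⁻¹ x ≤ k + 1 := by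
      intro F f hFf hf x h1 h2
      have h3 := hfix f hf (f⁻¹ x)
      rw [RelIso.apply_inv_self] at h3
      have h4 := h3.1.1 h1
      have h5 := h3.2.1 h2
      refine ⟨F.injective ?_, h4, h5⟩
      rw [hFf _ h4 h5]
      simp
    simp only [RelIso.mul_apply]
    obtain ⟨e1, a1, b1⟩ := hinv K (l k) (hK k) (hl k) x h1 h2
    obtain ⟨e2, a2, b2⟩ := hinv H (h k) (hH k) (hh k) _ a1 b1
    have h3 := hfix (l k) (hl k) ((h k)⁻¹ ((l k)⁻¹ x))
    rw [e1, e2, hK k _ a2 b2, hH k _ (h3.1.2 a2) (h3.2.2 b2)]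
  · rw [hg x hx]
    simp only [RelIso.mul_apply]
    rw [inv_apply_eq_self (hK' x hx), inv_apply_eq_self (hH' x hx), hK' x hx, hH' x hx]

/-- For some label `n`, every automorphism supported on the `n`-th block extends to an element of
`U n` supported on the union of all blocks. -/
theorem IsExhaustion.exists_blockSet_extension {U : ℕ → Set (ℚ ≃o ℚ)} (hU : IsExhaustion U) :
    ∃ n, ∀ g : ℚ ≃o ℚ, (∀ x ∉ blockSet n, g x = x) →
      ∃ u ∈ U n, (∀ x ∈ blockSet n, u x = g x) ∧ ∀ x, (∀ i, x ∉ blockSet i) → u x = x := by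
  -- Diagonal argument: glue the bad `g n`, each on its own block. The result `f` lies in some `U
  -- n`, extends `g n`, and is the identity off all blocks.
  by_contra! hcon
  choose g hg hbad using hcon
  obtain ⟨f, hf⟩ := exists_orderIso_glue (a := fun k : ℤ => (k : ℚ)) (b := fun k : ℤ => (k : ℚ))
      Int.cast_strictMono Int.cast_strictMono unboundedBothWays_intCast unboundedBothWays_intCast
      (fun k => g (blockIndex k)) (fun k => hg _ _ (intCast_notMem_blockSet _ _))
      (fun k => hg _ _ (intCast_notMem_blockSet _ _))
  push_cast at hf
  obtain ⟨n, hn⟩ := hU.exists_mem f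
  obtain ⟨x, hx, hne⟩ := hbad n f hn fun x hx => by
    obtain ⟨k, hk, h1, h2⟩ := hx
    rw [hf k x h1.le (by linarith), hk]
  rw [hf ⌊x⌋ x (Int.floor_le x) (Int.lt_floor_add_one x).le] at hne
  exact hne (hg _ _ (hx _))

/-- Some member of an exhaustion contains all automorphisms supported on some block. -/
theorem IsExhaustion.exists_supported_mem {U : ℕ → Set (ℚ ≃o ℚ)} (hU : IsExhaustion U) :
    ∃ n m, ∀ g : ℚ ≃o ℚ, (∀ x ∉ blockSet n, g x = x) → g ∈ U m := by
  obtain ⟨n, hn⟩ := hU.exists_blockSet_extension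
  -- `t` preserves the block `n` and moves all others off the union of the blocks.
  obtain ⟨t, ht⟩ := exists_orderIso_map_intervals (p := fun k : ℤ => (k : ℚ))
    (q := fun k : ℤ => k + 1 / 2)
    -- The interval from `k + 5 / 8` to `k + 3 / 4` lies in the gap between the blocks, which
    -- contains no point of any `blockSet`.
    (p' := fun k : ℤ => if blockIndex k = n then (k : ℚ) else k + 5 / 8)
    (q' := fun k : ℤ => if blockIndex k = n then (k : ℚ) + 1 / 2 else k + 3 / 4)
    (fun k => by linarith) (fun k => by push_cast; linarith)
    (fun k => by split_ifs <;> linarith) (fun k => by split_ifs <;> push_cast <;> linarith)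
    unboundedBothWays_intCast
    ⟨fun x => ⟨⌊x⌋ - 1, by have := Int.floor_le x; push_cast; split_ifs <;> linarith⟩,
      fun x => ⟨⌊x⌋ + 1, by have := Int.lt_floor_add_one x; push_cast; split_ifs <;> linarith⟩⟩
  have ht1 : ∀ x, t x ∈ blockSet n ↔ x ∈ blockSet n := by
    have hk : ∀ x (k : ℤ), blockIndex k = n → ((k : ℚ) < t x ∧ t x < k + 1 / 2 ↔
        (k : ℚ) < x ∧ x < k + 1 / 2) := by
      intro x k hk
      have := ht k
      simp only [hk, if_true] at this
      rw [← t.lt_iff_lt (x := (k : ℚ)) (y := x), ← t.lt_iff_lt (x := x), this.1, this.2]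
    exact fun x => exists_congr fun k => and_congr_right fun h => hk x k h
  have ht2 : ∀ x i j, x ∈ blockSet i → t x ∈ blockSet j → x ∈ blockSet n := by
    rintro x i j ⟨k, hk, h1, h2⟩ hj
    by_contra hx
    have hkn : blockIndex k ≠ n := fun h => hx ⟨k, h, h1, h2⟩
    have := ht k
    simp only [hkn, if_false] at this
    have h3 := t.strictMono h1
    have h4 := t.strictMono h2
    rw [this.1] at h3
    rw [this.2] at h4
    have := (blockIndex_eq_of_mem (k := k) hj (by linarith) (by linarith)).2.2
    linarith
  obtain ⟨m₀, hm₀⟩ := hU.exists_mem t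
  obtain ⟨m, hnm, hm⟩ : ∃ m, n ≤ m ∧ t ∈ U m :=
    ⟨max n m₀, le_max_left _ _, hU.mono (le_max_right _ _) hm₀⟩
  refine ⟨n, m + 5, fun g hg => ?_⟩
  obtain ⟨h, l, hh, hl, rfl⟩ := exists_commutator_on_blockSet hg
  obtain ⟨h', hh'U, hh', hh's⟩ := hn h hh
  -- Conjugating back, `t * s * t⁻¹` agrees with `l` on block `n` and is otherwise supported on the
  -- `t`-image of the blocks. That image meets the blocks only inside block `n`, so outside block
  -- `n` each point is fixed by `h'` or by `t * s * t⁻¹`.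
  obtain ⟨s, hsU, hs, hss⟩ := hn (t⁻¹ * l * t) fun x hx => by
    simp [RelIso.mul_apply, hl _ (mt (ht1 x).1 hx)]
  have hl'U : t * s * t⁻¹ ∈ U (m + 2) :=
    hU.mul_mem_of_le (by lia) (hU.mul_mem_of_le hnm hm hsU) (hU.inv_mem _ _ hm)
  rw [← commutator_eq_of_agree hh hl hh' (l' := t * s * t⁻¹)]
  · have h1 : h' ∈ U (m + 2) := hU.mono (by lia) hh'U
    exact hU.mul_mem_of_le (by lia) (hU.mul_mem_of_le (by lia) (hU.mul_mem _ _ _ h1 hl'U)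
      (hU.inv_mem _ _ h1)) (hU.inv_mem _ _ hl'U)
  · intro x hx
    have : t⁻¹ x ∈ blockSet n := by rwa [← ht1, RelIso.apply_inv_self]
    simp [RelIso.mul_apply, hs _ this]
  · intro x hx
    by_cases hxs : ∀ i, x ∉ blockSet i
    · exact .inl (hh's x hxs)
    · push Not at hxs
      obtain ⟨j, hj⟩ := hxs
      right
      simp only [RelIso.mul_apply]
      rw [hss, RelIso.apply_inv_self]
      intro i hi
      refine hx ?_
      rw [← RelIso.apply_inv_self t x] at hj ⊢
      exact (ht1 _).2 (ht2 _ i j hi hj)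

/-! ### Automorphisms fixing far intervals, and the exhaustion theorem -/

/-- `f` is the identity on nondegenerate intervals arbitrarily far to the left and to the right. -/
def FixesFarIntervals (f : ℚ ≃o ℚ) : Prop :=
  (∀ x, ∃ p q, x < p ∧ p < q ∧ ∀ y ∈ Set.Icc p q, f y = y) ∧
    ∀ x, ∃ p q, p < q ∧ q < x ∧ ∀ y ∈ Set.Icc p q, f y = y

theorem FixesFarIntervals.of_sequence {f : ℚ ≃o ℚ} {p : ℤ → ℚ} (hu : UnboundedBothWays p)
    (h : ∀ k, ∃ a b, p k ≤ a ∧ a < b ∧ b ≤ p (k + 1) ∧ ∀ y ∈ Set.Icc a b, f y = y) :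
    FixesFarIntervals f := by
  constructor
  · intro x
    obtain ⟨k, hk⟩ := hu.2 x
    obtain ⟨a, b, h1, h2, -, h4⟩ := h k
    exact ⟨a, b, hk.trans_le h1, h2, h4⟩
  · intro x
    obtain ⟨k, hk⟩ := hu.1 (x - 1)
    obtain ⟨a, b, -, h2, h3, h4⟩ := h (k - 1)
    rw [sub_add_cancel] at h3
    exact ⟨a, b, h2, by linarith, h4⟩

/-- An automorphism can be modified to be the identity outside an interval while remaining
unchanged on a smaller one. -/
theorem exists_orderIso_cutoff (f : ℚ ≃o ℚ) {P p q Q : ℚ} (hPp : P < p) (hpq : p < q) (hqQ : q < Q)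
    (hPf : P < f p) (hfQ : f q < Q) :
    ∃ φ : ℚ ≃o ℚ, φ P = P ∧ (∀ x ∈ Set.Icc p q, φ x = f x) ∧ ∀ x, Q ≤ x → φ x = x := by
  obtain ⟨α, hα, hα'⟩ := exists_orderIso_map_pair hPp hPf
  obtain ⟨β, hβ, hβ'⟩ := exists_orderIso_map_pair hqQ hfQ
  obtain ⟨γ, hγ, hγ'⟩ := exists_orderIso_glue_at α f p hα'
  obtain ⟨δ, hδ, hδ'⟩ := exists_orderIso_glue_at γ β q (by rw [hγ' q hpq.le, hβ])
  obtain ⟨ε, hε, hε'⟩ := exists_orderIso_glue_at δ 1 Q (by rw [hδ' Q hqQ.le, hβ']; rfl)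
  refine ⟨ε, ?_, fun x hx => ?_, fun x hx => hε' x hx⟩
  · rw [hε _ (by linarith), hδ _ (by linarith), hγ _ hPp.le, hα]
  · rw [hε _ (hx.2.trans hqQ.le), hδ _ hx.2, hγ' _ hx.1]

/-- Choose `g` alternating between stretches where it equals `f` and stretches where it is the
identity. Then `g⁻¹ * f` is the identity exactly where it is needed, on the stretches of the first
kind. -/
theorem exists_eq_mul_fixesFarIntervals (f : ℚ ≃o ℚ) :
    ∃ g g' : ℚ ≃o ℚ, FixesFarIntervals g ∧ FixesFarIntervals g' ∧ f = g * g' := by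
  obtain ⟨P, Q, hPQ, hQP, hT, hu⟩ := exists_intervals
    (fun _ P Q => ∃ p q, P < p ∧ p < q ∧ q < Q ∧ P < f p ∧ f q < Q)
    -- Choosing `p` beyond `f⁻¹ P` gives `P < f p`; then `Q` is taken beyond both `q` and `f q`.
    (fun _ x => by
      obtain ⟨p, hp⟩ := exists_gt (max (x + 1) (f.symm (x + 1)))
      obtain ⟨Q, hQ⟩ := exists_gt (max (p + 1) (f (p + 1)))
      rw [max_lt_iff] at hp hQ
      have h1 := f.symm_apply_lt.1 hp.2
      exact ⟨x + 1, Q, by linarith, by linarith, p, p + 1, hp.1, by linarith, hQ.1, h1, hQ.2⟩)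
    (fun _ x => by
      obtain ⟨q, hq⟩ := exists_lt (min (x - 1) (f.symm (x - 1)))
      obtain ⟨P, hP⟩ := exists_lt (min (q - 1) (f (q - 1)))
      rw [lt_min_iff] at hq hP
      have h1 := f.lt_symm_apply.1 hq.2
      exact ⟨P, x - 1, by linarith, by linarith, q - 1, q, hP.1, by linarith, hq.1, hP.2, h1⟩)
  choose p q h1 h2 h3 h4 h5 using hT
  choose φ hφ hφf hφQ using fun k => exists_orderIso_cutoff f (h1 k) (h2 k) (h3 k) (h4 k) (h5 k)
  have hP : StrictMono P := strictMono_int_of_lt_succ fun k => (hPQ k).trans (hQP k)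
  obtain ⟨g, hg⟩ := exists_orderIso_glue hP hP hu hu φ hφ (fun k => hφQ k _ (hQP k).le)
  refine ⟨g, g⁻¹ * f, .of_sequence hu fun k => ?_, .of_sequence hu fun k => ?_,
    by group⟩
  · refine ⟨Q k, P (k + 1), (hPQ k).le, hQP k, le_rfl, fun y hy => ?_⟩
    rw [hg k y ((hPQ k).le.trans hy.1) hy.2, hφQ k y hy.1]
  · refine ⟨p k, q k, (h1 k).le, h2 k, ((h3 k).trans (hQP k)).le, fun y hy => ?_⟩
    have : f y = g y := by
      rw [hg k y ((h1 k).le.trans hy.1) (hy.2.trans ((h3 k).trans (hQP k)).le), hφf k y hy]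
    simp [RelIso.mul_apply, this]

/-- For some label `n`, the intervals with label `n` can be moved into the fixed points of any
given automorphism that fixes far intervals, by an element of `U n`. -/
theorem IsExhaustion.exists_map_into_fixedPoints {U : ℕ → Set (ℚ ≃o ℚ)} (hU : IsExhaustion U) :
    ∃ n, ∀ f : ℚ ≃o ℚ, FixesFarIntervals f → ∃ v ∈ U n, ∀ k : ℤ, blockIndex k = n →
      ∀ x : ℚ, k ≤ x → x ≤ k + 1 / 2 → f (v x) = v x := by
  -- Diagonal argument: a single `v` carries each `[k, k + 1/2]` onto an interval fixed pointwise by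
  -- the bad `f (blockIndex k)`. It lies in some `U n`, contradicting the choice of `f n`.
  by_contra! hcon
  choose f hf hbad using hcon
  obtain ⟨p, q, hpq, hqp, hT, hu⟩ := exists_intervals
    (fun k p q => ∀ y ∈ Set.Icc p q, f (blockIndex k) y = y)
    (fun k => (hf (blockIndex k)).1) (fun k => (hf (blockIndex k)).2)
  obtain ⟨v, hv⟩ := exists_orderIso_map_intervals (p := fun k : ℤ => (k : ℚ))
    (q := fun k : ℤ => k + 1 / 2) (fun k => by linarith) (fun k => by push_cast; linarith)
    hpq hqp unboundedBothWays_intCast hu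
  obtain ⟨n, hn⟩ := hU.exists_mem v
  obtain ⟨k, hk, x, h1, h2, hne⟩ := hbad n v hn
  subst hk
  refine hne (hT k _ ⟨?_, ?_⟩)
  · rw [← (hv k).1]; exact v.monotone h1
  · rw [← (hv k).2]; exact v.monotone h2

theorem exists_blockIndex_intervals (n : ℕ) : ∃ p q : ℤ → ℚ, (∀ k, p k < q k) ∧
    (∀ k, q k < p (k + 1)) ∧
    (∀ k, ∃ j : ℤ, blockIndex j = n ∧ p k = j ∧ q k = j + 1 / 2) ∧ UnboundedBothWays p := by
  refine exists_intervals (fun _ p q => ∃ j : ℤ, blockIndex j = n ∧ p = j ∧ q = j + 1 / 2)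
    (fun _ x => ?_) fun _ x => ?_
  · obtain ⟨j, hj, h⟩ := exists_gt_blockIndex_eq n x
    exact ⟨j, j + 1 / 2, hj, by linarith, j, h, rfl, rfl⟩
  · obtain ⟨j, hj, h⟩ := exists_lt_blockIndex_eq n (x - 1)
    exact ⟨j, j + 1 / 2, by linarith, by linarith, j, h, rfl, rfl⟩

/-- A fixed automorphism mapping the complement of the closed intervals with label `n` into the
block with label `n'`. -/
theorem exists_orderIso_map_into_blockSet (n n' : ℕ) : ∃ w : ℚ ≃o ℚ, ∀ x : ℚ,
    (∃ k : ℤ, blockIndex k = n ∧ k ≤ x ∧ x ≤ k + 1 / 2) ∨ w x ∈ blockSet n' := by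
  obtain ⟨p, q, hpq, hqp, hT, hu⟩ := exists_blockIndex_intervals n
  obtain ⟨p', q', hpq', hqp', hT', hu'⟩ := exists_blockIndex_intervals n'
  have hp : StrictMono p := strictMono_int_of_lt_succ fun k => (hpq k).trans (hqp k)
  obtain ⟨w, hw⟩ := exists_orderIso_map_intervals (p := q) (q := fun k => p (k + 1)) hqp
    (fun k => hpq (k + 1)) hpq' hqp'
    ⟨fun x => by
      obtain ⟨k, hk⟩ := hu.1 x
      exact ⟨k - 1, by have := hqp (k - 1); rw [sub_add_cancel] at this; linarith⟩,
      fun x => (hu.2 x).imp fun k hk => hk.trans (hpq k)⟩ hu'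
  refine ⟨w, fun x => ?_⟩
  obtain ⟨k, hk, hk'⟩ := hu.exists_mem_Ico hp x
  by_cases hx : x ≤ q k
  · left
    obtain ⟨j, hj, hj1, hj2⟩ := hT k
    exact ⟨j, hj, hj1 ▸ hk, hj2 ▸ hx⟩
  · right
    obtain ⟨j, hj, hj1, hj2⟩ := hT' k
    refine ⟨j, hj, ?_, ?_⟩
    · rw [← hj1, ← (hw k).1]; exact w.strictMono (not_le.1 hx)
    · rw [← hj2, ← (hw k).2]; exact w.strictMono hk'

/-- An exhaustion of the group of order automorphisms of `ℚ` is eventually the whole group. -/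
theorem IsExhaustion.exists_eq_univ {U : ℕ → Set (ℚ ≃o ℚ)} (hU : IsExhaustion U) :
    ∃ n, U n = Set.univ := by
  obtain ⟨n', m, hm⟩ := hU.exists_supported_mem
  obtain ⟨n, hn⟩ := hU.exists_map_into_fixedPoints
  obtain ⟨w, hw⟩ := exists_orderIso_map_into_blockSet n n'
  obtain ⟨i, hi⟩ := hU.exists_mem w
  let M := m + n + i
  have hwM : w ∈ U M := hU.mono (by lia) hi
  have key : ∀ f, FixesFarIntervals f → f ∈ U (M + 4) := by
    intro f hf
    obtain ⟨v, hvU, hv⟩ := hn f hf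
    have hvM : v ∈ U M := hU.mono (by lia) hvU
    -- `v⁻¹ * f * v` fixes the closed intervals with label `n` pointwise, and `w` maps everything
    -- else into block `n'`, so this conjugate is supported on that block. Recovering `f` takes four
    -- further multiplications, whence `M + 4`.
    have h1 : w * v⁻¹ * f * v * w⁻¹ ∈ U M := by
      refine hU.mono (show m ≤ M by lia) (hm _ fun y hy => ?_)
      obtain ⟨k, hk, h1, h2⟩ := (hw (w⁻¹ y)).resolve_right (by rwa [RelIso.apply_inv_self])
      simp [RelIso.mul_apply, hv k hk _ h1 h2]
    have h2 : f = v * w⁻¹ * (w * v⁻¹ * f * v * w⁻¹) * w * v⁻¹ := by group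
    rw [h2]
    exact hU.mul_mem_of_le (by lia) (hU.mul_mem_of_le (by lia) (hU.mul_mem_of_le (by lia)
      (hU.mul_mem_of_le le_rfl hvM (hU.inv_mem _ _ hwM)) h1) hwM) (hU.inv_mem _ _ hvM)
  refine ⟨M + 5, Set.eq_univ_of_forall fun f => ?_⟩
  obtain ⟨g, g', hg, hg', rfl⟩ := exists_eq_mul_fixesFarIntervals f
  exact hU.mul_mem _ _ _ (key g hg) (key g' hg')

/-! ### Cofinalities and Bergman's property -/

section Group

variable {G : Type u} [Group G]

/-- The exponents `2 ^ n` double, so a product of two elements of one term lies in the next. -/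
theorem hasBergmanProperty_of_isExhaustion
    (h : ∀ U : ℕ → Set G, IsExhaustion U → ∃ n, U n = Set.univ) : HasBergmanProperty G := by
  intro X hX hinv hone
  have hmono : Monotone (fun n : ℕ => X ^ n) := fun m n hmn => Set.pow_subset_pow_right hone hmn
  have hinv' : ∀ n : ℕ, ∀ x, x ∈ X ^ n → x⁻¹ ∈ X ^ n := fun n x hx => by
    rw [hinv, inv_pow, Set.mem_inv, inv_inv]
    exact hx
  obtain ⟨n, hn⟩ := h (fun n => X ^ (2 ^ n))
    { mono := fun m n hmn => hmono (Nat.pow_le_pow_right two_pos hmn)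
      inv_mem := fun n => hinv' _
      mul_mem := fun n x y hx hy => by
        rw [pow_succ, mul_two, pow_add]
        exact Set.mul_mem_mul hx hy
      exists_mem := fun x => by
        have hx : x ∈ Subgroup.closure X := by rw [hX]; trivial
        have : ∃ n : ℕ, x ∈ X ^ n := by
          induction hx using Subgroup.closure_induction with
          | mem x hx => exact ⟨1, by rwa [pow_one]⟩
          | one => exact ⟨0, by simp⟩
          | mul x y _ _ hx hy =>
            obtain ⟨m, hm⟩ := hx
            obtain ⟨n, hn⟩ := hy
            exact ⟨m + n, by rw [pow_add]; exact Set.mul_mem_mul hm hn⟩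
          | inv x _ hx => exact hx.imp fun n => hinv' n x
        obtain ⟨n, hn⟩ := this
        exact ⟨n, hmono Nat.lt_two_pow_self.le hn⟩ }
  exact ⟨2 ^ n, hn⟩

/-- An infinite group with Bergman's property is not finitely generated. -/
theorem HasBergmanProperty.not_fg [Infinite G] (h : HasBergmanProperty G) : ¬ Group.FG G := by
  intro hfg
  obtain ⟨S, hS, hfin⟩ := Group.fg_iff.1 hfg
  obtain ⟨N, hN⟩ := h (insert 1 (S ∪ S⁻¹))
    (top_unique (hS ▸ Subgroup.closure_mono fun x hx => .inr (.inl hx)))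
    (by simp [Set.union_comm]) (Set.mem_insert _ _)
  have : (insert 1 (S ∪ S⁻¹)).Finite := (hfin.union hfin.inv).insert 1
  have hpow : ∀ n : ℕ, ((insert 1 (S ∪ S⁻¹)) ^ n).Finite := fun n => by
    induction n with
    | zero => simp
    | succ n ih => rw [pow_succ]; exact ih.mul this
  exact Set.infinite_univ (hN ▸ hpow N)

/-- A group that is not finitely generated is the union of a chain of proper subgroups. -/
theorem exists_chain_subgroups (h : ¬ Group.FG G) : ∃ C : Set (Subgroup G),
    IsChain (· ≤ ·) C ∧ (∀ H ∈ C, H ≠ ⊤) ∧ (⋃ H ∈ C, (H : Set G)) = Set.univ := by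
  -- Take a generating set of least cardinality, well-ordered in the least order type. Each closed
  -- initial segment `D x` is strictly smaller than `X`, as `X` is infinite, so by minimality it
  -- generates a proper subgroup.
  obtain ⟨X, hX, hmin⟩ := exists_minimalFor_of_wellFoundedLT
    (fun X : Set G => Subgroup.closure X = ⊤) (fun X => Cardinal.mk X) ⟨Set.univ, by simp⟩
  have hinf : Cardinal.aleph0 ≤ Cardinal.mk X := by
    by_contra hlt
    exact h (Group.fg_iff.2 ⟨X, hX, Cardinal.lt_aleph0_iff_set_finite.1 (not_le.1 hlt)⟩)
  obtain ⟨r, hr, hord⟩ := Cardinal.exists_ord_eq X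
  let D : X → Set G := fun x => {g | ∃ y : X, g = y ∧ (r y x ∨ y = x)}
  have hDmono : ∀ x y, r x y → D x ⊆ D y := by
    rintro x y hxy _ ⟨z, rfl, hz⟩
    refine ⟨z, rfl, .inl ?_⟩
    rcases hz with hz | rfl
    · exact _root_.trans hz hxy
    · exact hxy
  have hdir : ∀ x y, D x ⊆ D y ∨ D y ⊆ D x := by
    intro x y
    rcases trichotomous_of r x y with hxy | rfl | hxy
    · exact .inl (hDmono _ _ hxy)
    · exact .inl subset_rfl
    · exact .inr (hDmono _ _ hxy)
  have hDcard : ∀ x, Cardinal.mk (D x) < Cardinal.mk X := by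
    intro x
    have hsub : D x ⊆ Subtype.val '' ({y | r y x} ∪ {x} : Set X) := by
      rintro _ ⟨y, rfl, hy⟩
      exact ⟨y, hy, rfl⟩
    calc Cardinal.mk (D x) ≤ Cardinal.mk ({y | r y x} ∪ {x} : Set X) :=
          (Cardinal.mk_le_mk_of_subset hsub).trans Cardinal.mk_image_le
      _ ≤ Cardinal.mk {y | r y x} + Cardinal.mk ({x} : Set X) := Cardinal.mk_union_le _ _
      _ < _ := Cardinal.add_lt_of_lt hinf (Cardinal.card_typein_lt x hord)
        (by simpa using Cardinal.one_lt_aleph0.trans_le hinf)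
  have hne : Nonempty X := Cardinal.mk_ne_zero_iff.1 (Cardinal.aleph0_pos.trans_le hinf).ne'
  refine ⟨Set.range fun x => Subgroup.closure (D x), ?_, ?_, ?_⟩
  · rintro _ ⟨x, rfl⟩ _ ⟨y, rfl⟩ -
    exact (hdir x y).imp (fun h => Subgroup.closure_mono h) fun h => Subgroup.closure_mono h
  · rintro _ ⟨x, rfl⟩ htop
    exact (hDcard x).not_ge (hmin htop (hDcard x).le)
  · have hd : Directed (· ≤ ·) fun x => Subgroup.closure (D x) := fun x y =>
      (hdir x y).elim (fun hxy => ⟨y, Subgroup.closure_mono hxy, le_rfl⟩)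
        fun hyx => ⟨x, le_rfl, Subgroup.closure_mono hyx⟩
    rw [Set.biUnion_range, ← Subgroup.coe_iSup_of_directed hd, ← Subgroup.coe_top,
      SetLike.coe_set_eq, ← top_le_iff, ← hX, Subgroup.closure_le]
    intro x hx
    exact Subgroup.mem_iSup_of_mem ⟨x, hx⟩ (Subgroup.subset_closure ⟨⟨x, hx⟩, rfl, .inr rfl⟩)

/-- A countable chain as in the definition of the strong cofinality refines to an exhaustion
by members of the chain. -/
theorem exists_isExhaustion_of_chain {C : Set (Set G)} (hC : IsChain (· ⊆ ·) C)
    (hcount : C.Countable) (hinv : ∀ H ∈ C, H = H⁻¹)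
    (hmul : ∀ H ∈ C, ∃ K ∈ C, H ⊆ K ∧ H * H ⊆ K) (hcover : ⋃₀ C = Set.univ) :
    ∃ U : ℕ → Set G, IsExhaustion U ∧ ∀ n, U n ∈ C := by
  have hmem : ∀ x : G, ∃ H ∈ C, x ∈ H := fun x => by
    simpa using (hcover ▸ Set.mem_univ x : x ∈ ⋃₀ C)
  have hne : C.Nonempty := (hmem 1).imp fun H hH => hH.1
  obtain ⟨V, hV⟩ := hcount.exists_eq_range hne
  have hVC : ∀ n, V n ∈ C := fun n => hV ▸ Set.mem_range_self n
  -- Requiring the next member to contain `V n` as well makes the recursive sequence absorb the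
  -- whole enumerated chain.
  have hnext : ∀ (n : ℕ) (H : C), ∃ K : C, (H : Set G) ⊆ K ∧ (H * H : Set G) ⊆ K ∧ V n ⊆ K := by
    intro n H
    obtain ⟨K, hK, h1, h2⟩ := hmul H H.2
    rcases hC.total hK (hVC n) with h3 | h3
    · exact ⟨⟨V n, hVC n⟩, h1.trans h3, h2.trans h3, subset_rfl⟩
    · exact ⟨⟨K, hK⟩, h1, h2, h3⟩
  choose next h1 h2 h3 using hnext
  obtain ⟨W, hW⟩ : ∃ W : ℕ → C, ∀ n, W (n + 1) = next n (W n) :=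
    ⟨fun n => Nat.rec (motive := fun _ => C) ⟨V 0, hVC 0⟩ next n, fun _ => rfl⟩
  refine ⟨fun n => (W n).1, ⟨monotone_nat_of_le_succ fun n => hW n ▸ h1 n (W n), fun n x hx => ?_,
    fun n x y hx hy => hW n ▸ h2 n (W n) (Set.mul_mem_mul hx hy), fun x => ?_⟩, fun n => (W n).2⟩
  · have hx' : x ∈ (W n).1 := hx
    rw [hinv _ (W n).2] at hx'
    exact hx'
  · obtain ⟨H, hH, hx⟩ := hmem x
    rw [hV] at hH
    obtain ⟨n, rfl⟩ := hH
    exact ⟨n + 1, hW n ▸ h3 n (W n) hx⟩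

end Group

theorem mainTheorem4 :
    Cardinal.aleph0 < groupStrongCofinality (ℚ ≃o ℚ) ∧
    Cardinal.aleph0 < groupCofinality (ℚ ≃o ℚ) ∧
    HasBergmanProperty (ℚ ≃o ℚ) := by
  have hB : HasBergmanProperty (ℚ ≃o ℚ) :=
    hasBergmanProperty_of_isExhaustion fun U hU => hU.exists_eq_univ
  have : Infinite (ℚ ≃o ℚ) := Infinite.of_injective (fun x : ℚ => OrderIso.addRight x)
    fun x y hxy => by simpa using DFunLike.congr_fun hxy 0
  -- This chain shows that both sets of cardinals are nonempty, so `csInf_mem` applies. As subgroups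
  -- satisfy `H * H ⊆ H`, a chain of subgroups is also a chain for the strong cofinality, and
  -- `hcountable` excludes countable chains of both kinds.
  obtain ⟨C, hC, hproper, hcover⟩ := exists_chain_subgroups hB.not_fg
  have hchain : ∀ C : Set (Subgroup (ℚ ≃o ℚ)), IsChain (· ≤ ·) C →
      IsChain (· ⊆ ·) ((fun H : Subgroup (ℚ ≃o ℚ) => (H : Set (ℚ ≃o ℚ))) '' C) := by
    rintro C hC _ ⟨H, hH, rfl⟩ _ ⟨K, hK, rfl⟩ -
    exact hC.total hH hK
  have hinv : ∀ H : Subgroup (ℚ ≃o ℚ), (H : Set (ℚ ≃o ℚ)) = (H : Set (ℚ ≃o ℚ))⁻¹ := fun H => by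
    simp
  have hmul : ∀ H : Subgroup (ℚ ≃o ℚ), (H : Set (ℚ ≃o ℚ)) * H ⊆ H := fun H => by simp
  have hcountable : ∀ C : Set (Set (ℚ ≃o ℚ)), IsChain (· ⊆ ·) C → C.Countable →
      (∀ H ∈ C, H ≠ Set.univ) → (∀ H ∈ C, H = H⁻¹) →
      (∀ H ∈ C, ∃ K ∈ C, H ⊆ K ∧ H * H ⊆ K) → ⋃₀ C = Set.univ → False := by
    intro C hC hcount hne hinv hmul hcover
    obtain ⟨U, hU, hUC⟩ := exists_isExhaustion_of_chain hC hcount hinv hmul hcover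
    obtain ⟨n, hn⟩ := hU.exists_eq_univ
    exact hne _ (hUC n) hn
  refine ⟨?_, ?_, hB⟩
  · obtain ⟨C', hC', hcard, hne, hinv', hmul', hcov⟩ := csInf_mem
      (s := {c : Cardinal | ∃ C : Set (Set (ℚ ≃o ℚ)),
        IsChain (· ⊆ ·) C ∧ Cardinal.mk C = c ∧ (∀ H ∈ C, H ≠ Set.univ) ∧
        (∀ H ∈ C, H = H⁻¹) ∧ (∀ H ∈ C, ∃ K ∈ C, H ⊆ K ∧ H * H ⊆ K) ∧ ⋃₀ C = Set.univ})
      ⟨_, _, hchain C hC, rfl, by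
        rintro _ ⟨H, hH, rfl⟩
        simpa using hproper H hH, by
        rintro _ ⟨H, hH, rfl⟩
        exact hinv H, by
        rintro _ ⟨H, hH, rfl⟩
        exact ⟨H, ⟨H, hH, rfl⟩, subset_rfl, hmul H⟩, by
        rw [Set.sUnion_image]; exact hcover⟩
    by_contra hlt
    refine hcountable C' hC' ?_ hne hinv' hmul' hcov
    rw [← Cardinal.le_aleph0_iff_set_countable, hcard]
    exact not_lt.1 hlt
  · obtain ⟨C', hC', hcard, hne, hcov⟩ := csInf_mem
      (s := {c : Cardinal | ∃ C : Set (Subgroup (ℚ ≃o ℚ)),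
        IsChain (· ≤ ·) C ∧ Cardinal.mk C = c ∧ (∀ H ∈ C, H ≠ ⊤) ∧
        (⋃ H ∈ C, (H : Set (ℚ ≃o ℚ))) = Set.univ})
      ⟨_, C, hC, rfl, hproper, hcover⟩
    by_contra hlt
    refine hcountable _ (hchain C' hC') (Set.Countable.image ?_ _) ?_ ?_ ?_ ?_
    · rw [← Cardinal.le_aleph0_iff_set_countable, hcard]
      exact not_lt.1 hlt
    · rintro _ ⟨H, hH, rfl⟩
      simpa using hne H hH
    · rintro _ ⟨H, hH, rfl⟩
      exact hinv H
    · rintro _ ⟨H, hH, rfl⟩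
      exact ⟨H, ⟨H, hH, rfl⟩, subset_rfl, hmul H⟩
    · rw [Set.sUnion_image]; exact hcov
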